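/- An \emph{algebra} here is a nonempty set with two binary operations $+$ and $\cdot$. A \emph{variety} is a class of algebras closed under subalgebras, homomorphic images and arbitrary direct products, $\mathsf V(A)$ is the variety generated by $A$, and a variety is \emph{nonfinitely based} if it is not the class of all algebras satisfying some finite set of identities. For varieties $\mathcal V_1\subseteq\mathcal V_2$, the interval $[\mathcal V_1,\mathcal V_2]$ is the class of all subvarieties of $\mathcal V_2$ that contain $\mathcal V_1$. Consider the following additively idempotent semirings. * $S_c(abc)$ consists of the nonempty subwords $a,b,c,ab,ac,bc,abc$ of the word $abc$ in the free commutative semigroup on three letters, and an element $0$. The product of two words is their product in the free commutative semigroup if this is a subword of $abc$, and all other products are $0$; moreover $x+x=x$ for all $x$, and $x+y=0$ for all $x\ne y$. * $S_7=\{\infty,a,1\}$ has $x+x=x$ and $x+y=\infty$ for $x\neq y$; the element $1$ is a multiplicative identity, $\infty$ is a multiplicative zero, and $a\cdot a=\infty$. * $S_7^0=S_7\cup\{0\}$ is obtained from $S_7$ by adding a new element $0$ with $x+0=0+x=x$ and $x0=0x=0$ for all $x$. * $D_2$ is the $2$-element distributive lattice, with join as $+$ and meet as $\cdot$. Then $\mathsf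 V(S_c(abc))\subseteq\mathsf V(S_7^0)$, and every variety in the interval $[\mathsf V(S_c(abc)),\mathsf V(S_7^0)]$ is nonfinitely based. Moreover, every subvariety of $\mathsf V(S_7^0)$ that contains $S_7$ and $D_2$ belongs to this interval, and hence is nonfinitely based. -/

import Mathlib

universe u v

/-- An algebra with two binary operations `+` and `*` (no laws assumed) on a nonempty set. -/
structure Alg : Type (u + 1) where
  carrier : Type u
  [instAdd : Add carrier]
  [instMul : Mul carrier]
  [instNonempty : Nonempty carrier]

namespace Alg

instance : CoeSort Alg.{u} (Type u) := ⟨Alg.carrier⟩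

instance (A : Alg.{u}) : Add A := A.instAdd
instance (A : Alg.{u}) : Mul A := A.instMul
instance (A : Alg.{u}) : Nonempty A := A.instNonempty

/-- `f` preserves both operations. -/
def IsHom {A : Alg.{u}} {B : Alg.{v}} (f : A → B) : Prop :=
  (∀ x y : A, f (x + y) = f x + f y) ∧ ∀ x y : A, f (x * y) = f x * f y

/-- The direct product of a family of algebras, with componentwise operations. -/
def pi {ι : Type u} (A : ι → Alg.{u}) : Alg.{u} where
  carrier := (i : ι) → A i

/-- A copy of an algebra in a larger universe. -/
def lift (A : Alg.{0}) : Alg.{u} where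
  carrier := ULift.{u} A

end Alg

/-- A variety: a class of algebras closed under subalgebras, homomorphic images and arbitrary
direct products. (Closure under subalgebras is stated for isomorphic copies of subalgebras, i.e.
for algebras that embed into a member.) -/
structure IsVariety (V : Set Alg.{u}) : Prop where
  sub : ∀ (A B : Alg.{u}) (f : B → A), Alg.IsHom f → Function.Injective f → A ∈ V → B ∈ V
  image : ∀ (A B : Alg.{u}) (f : A → B), Alg.IsHom f → Function.Surjective f → A ∈ V → B ∈ V
  prod : ∀ (ι : Type u) (A : ι → Alg.{u}), (∀ i, A i ∈ V) → Alg.pi A ∈ V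

/-- The variety generated by `A`: the intersection of all varieties that contain `A`. -/
def varietyGen (A : Alg.{u}) : Set Alg.{u} :=
  {B | ∀ V : Set Alg.{u}, IsVariety V → A ∈ V → B ∈ V}

/-- The interval `[V₁, V₂]`: all subvarieties of `V₂` that contain `V₁`. -/
def varietyInterval (V₁ V₂ : Set Alg.{u}) : Set (Set Alg.{u}) :=
  {V | IsVariety V ∧ V₁ ⊆ V ∧ V ⊆ V₂}

/-- Terms in `+` and `*` over the countably infinite set of variables `x₀, x₁, x₂, …`. -/
inductive Term : Type
  | var : ℕ → Term
  | add : Term → Term → Term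
  | mul : Term → Term → Term

/-- The value of a term in `A` under an assignment of the variables. -/
def Term.eval {A : Alg.{u}} (ρ : ℕ → A) : Term → A
  | .var n => ρ n
  | .add s t => s.eval ρ + t.eval ρ
  | .mul s t => s.eval ρ * t.eval ρ

/-- `A` satisfies the identity `e.1 ≈ e.2`. -/
def Alg.Satisfies (A : Alg.{u}) (e : Term × Term) : Prop :=
  ∀ ρ : ℕ → A, e.1.eval ρ = e.2.eval ρ

/-- A class of algebras is finitely based if it is the class of all algebras that satisfy some
finite set of identities. -/
def FinitelyBased (V : Set Alg.{u}) : Prop :=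
  ∃ E : Set (Term × Term), E.Finite ∧ V = {A | ∀ e ∈ E, A.Satisfies e}

/-- The elements of `S_c(w)`: the nonempty subwords of the commutative word `w` (commutative words
are finite multisets of letters, their product is the sum of multisets), together with a new
symbol `0`, here `none`. -/
def ScCarrier {α : Type} (w : Multiset α) : Type :=
  Option {m : Multiset α // m ≠ 0 ∧ m ≤ w}

namespace ScCarrier

variable {α : Type} [DecidableEq α] {w : Multiset α}

instance : DecidableEq (ScCarrier w) :=
  inferInstanceAs (DecidableEq (Option {m : Multiset α // m ≠ 0 ∧ m ≤ w}))

/-- Flat addition: `x + x = x`, and `x + y = 0` for distinct `x`, `y`. -/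
instance : Add (ScCarrier w) := ⟨fun x y => if x = y then x else none⟩

/-- The product of two words, if it is a subword of `w`, and `0` otherwise. -/
instance : Mul (ScCarrier w) :=
  ⟨fun x y => match x, y with
    | some m, some n =>
      if h : m.1 + n.1 ≤ w then
        some ⟨m.1 + n.1, fun h0 => m.2.1 (add_eq_zero.1 h0).1, h⟩
      else none
    | _, _ => none⟩

instance : Nonempty (ScCarrier w) := ⟨none⟩

end ScCarrier

/-- The flat semiring `S_c(w)`. -/
def Sc {α : Type} [DecidableEq α] (w : Multiset α) : Alg.{0} where
  carrier := ScCarrier w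

/-- The flat semiring `S_c(abc)`, with three distinct letters `a = 0`, `b = 1`, `c = 2`. -/
def ScABC : Alg.{0} := Sc ({0, 1, 2} : Multiset (Fin 3))

/-- The three elements `∞`, `a`, `1` of `S₇`. -/
inductive S7Carrier : Type
  | inf
  | a
  | one

namespace S7Carrier

instance : Add S7Carrier :=
  ⟨fun x y => match x, y with
    | a, a => a
    | one, one => one
    | _, _ => inf⟩

instance : Mul S7Carrier :=
  ⟨fun x y => match x, y with
    | a, one => a
    | one, a => a
    | one, one => one
    | _, _ => inf⟩

instance : Nonempty S7Carrier := ⟨inf⟩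

end S7Carrier

/-- The ai-semiring `S₇`. -/
def S7 : Alg.{0} where
  carrier := S7Carrier

/-- The ai-semiring `S₇⁰`: a new element `0` is added to `S₇`, with `x + 0 = 0 + x = x` and
`x * 0 = 0 * x = 0` for all `x`. -/
def S70 : Alg.{0} where
  carrier := WithZero S7Carrier

/-- The 2-element distributive lattice, as a semiring with join as `+` and meet as `*`. -/
def D2 : Alg.{0} where
  carrier := Bool
  instAdd := ⟨fun x y => x ⊔ y⟩
  instMul := ⟨fun x y => x ⊓ y⟩

/-! ### Identities and varieties -/

/-! The inclusion holds because S_c(abc) is a homomorphic image of a subalgebra of S₇³, and S₇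
embeds in S₇⁰ (`ScABC_mem_of_S7_mem`). Any subvariety containing S₇ therefore contains S_c(abc).

Nonfinite basis rests on a 3-uniform hypergraph, a cyclic strip with M columns of four vertices,
that is richly 3-colourable locally but not globally. Its hyperedges, read as commutative words,
have a syntactic algebra: sets of words modulo "completed to hyperedges by the same words".

Locally, a small part of the strip avoids two consecutive columns, so it can be cut open and laid
out in the infinite strip. The infinite strip has enough rainbow colourings to separate hyperedges
from all other words (`mem_stripEdges_of_forall_colouring`). Rainbow colourings are assignments into
S_c(abc) sending each hyperedge to abc, so an identity of S_c(abc) in few variables passes to the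
syntactic algebra (`syntacticAlg_satisfies_of_ScABC`).

Globally, if 3 does not divide M, no set of vertices meets every hyperedge exactly once
(`three_dvd_of_exact_cover`). Hence S₇⁰ satisfies "sum of hyperedges ≈ the same sum plus the product
of all vertices" (`S70_satisfies`). The syntactic algebra fails this, because the product has the
wrong length to be a hyperedge.

Given a finite basis of a variety in the interval, take M large and prime to 3: the syntactic
algebra satisfies the basis, yet lies outside V(S₇⁰). -/

theorem Alg.IsHom.eval {A : Alg.{u}} {B : Alg.{v}} {f : A → B} (hf : Alg.IsHom f) (ρ : ℕ → A)
    (t : Term) : f (t.eval ρ) = t.eval (fun n => f (ρ n)) := by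
  induction t with
  | var n => rfl
  | add s t hs ht => simp only [Term.eval, hf.1, hs, ht]
  | mul s t hs ht => simp only [Term.eval, hf.2, hs, ht]

theorem Alg.Satisfies.of_injective {A : Alg.{u}} {B : Alg.{v}} {f : B → A} (hf : Alg.IsHom f)
    (hi : Function.Injective f) {e : Term × Term} (h : A.Satisfies e) : B.Satisfies e := by
  intro ρ
  apply hi
  rw [hf.eval, hf.eval]
  exact h _

theorem Alg.Satisfies.of_surjective {A : Alg.{u}} {B : Alg.{v}} {f : A → B} (hf : Alg.IsHom f)
    (hs : Function.Surjective f) {e : Term × Term} (h : A.Satisfies e) : B.Satisfies e := by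
  intro ρ
  choose g hg using hs
  have hρ : ρ = fun n => f (g (ρ n)) := by
    funext n
    exact (hg _).symm
  rw [hρ, ← hf.eval, ← hf.eval, h]

theorem Alg.isHom_proj {ι : Type u} (A : ι → Alg.{u}) (i : ι) :
    Alg.IsHom (A := Alg.pi A) (B := A i) (fun x => x i) :=
  ⟨fun _ _ => rfl, fun _ _ => rfl⟩

theorem Alg.Satisfies.pi {ι : Type u} {A : ι → Alg.{u}} {e : Term × Term}
    (h : ∀ i, (A i).Satisfies e) : (Alg.pi A).Satisfies e := by
  intro ρ
  funext i
  exact ((Alg.isHom_proj A i).eval ρ e.1).trans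
    ((h i _).trans ((Alg.isHom_proj A i).eval ρ e.2).symm)

theorem Alg.isHom_down (A : Alg.{0}) :
    Alg.IsHom (A := A.lift) (B := A) (ULift.down : ULift.{u} A → A) :=
  ⟨fun _ _ => rfl, fun _ _ => rfl⟩

theorem Alg.isHom_up (A : Alg.{0}) :
    Alg.IsHom (A := A) (B := A.lift) (ULift.up : A → ULift.{u} A) :=
  ⟨fun _ _ => rfl, fun _ _ => rfl⟩

theorem Alg.satisfies_lift_iff {A : Alg.{0}} {e : Term × Term} :
    A.lift.{u}.Satisfies e ↔ A.Satisfies e :=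
  ⟨fun h => h.of_injective A.isHom_up ULift.up_injective,
    fun h => h.of_injective A.isHom_down ULift.down_injective⟩

/-- The algebras satisfying a given set of identities form a variety. -/
theorem isVariety_models (E : Set (Term × Term)) :
    IsVariety {A : Alg.{u} | ∀ e ∈ E, A.Satisfies e} where
  sub _ _ _ hf hi h e he := (h e he).of_injective hf hi
  image _ _ _ hf hs h e he := (h e he).of_surjective hf hs
  prod _ _ h e he := Alg.Satisfies.pi fun i => h i e he

theorem satisfies_of_mem_varietyGen {A B : Alg.{u}} (hB : B ∈ varietyGen A) {e : Term × Term}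
    (h : A.Satisfies e) : B.Satisfies e :=
  hB _ (isVariety_models {e}) (by simpa using h) e rfl

theorem mem_varietyGen_self (A : Alg.{u}) : A ∈ varietyGen A := fun _ _ h => h

theorem isVariety_varietyGen (A : Alg.{u}) : IsVariety (varietyGen A) where
  sub A B f hf hi h V hV hA := hV.sub A B f hf hi (h V hV hA)
  image A B f hf hs h V hV hA := hV.image A B f hf hs (h V hV hA)
  prod ι A h V hV hA := hV.prod ι A fun i => h i V hV hA

theorem varietyGen_subset {A : Alg.{u}} {V : Set Alg.{u}} (hV : IsVariety V) (h : A ∈ V) :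
    varietyGen A ⊆ V := fun _ hB => hB V hV h

theorem IsVariety.lift_of_injective {A B : Alg.{0}} {V : Set Alg.{u}} (hV : IsVariety V)
    {f : B → A} (hf : Alg.IsHom f) (hi : Function.Injective f) (h : A.lift ∈ V) : B.lift ∈ V :=
  hV.sub A.lift B.lift (fun x : ULift B => (ULift.up (f x.down) : ULift A))
    ⟨fun x y => congrArg ULift.up (hf.1 x.down y.down),
      fun x y => congrArg ULift.up (hf.2 x.down y.down)⟩
    (fun _ _ h => ULift.down_injective (hi (ULift.up_injective h))) h

theorem S7_mem_of_S70_mem {V : Set Alg.{u}} (hV : IsVariety V) (h : S70.lift ∈ V) :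
    S7.lift ∈ V :=
  hV.lift_of_injective (A := S70) (B := S7) (f := fun x : S7Carrier => (x : WithZero S7Carrier))
    ⟨fun _ _ => rfl, fun _ _ => rfl⟩ (fun _ _ h => Option.some_injective _ h) h

/-! ### The elements of `S_c(w)` as words -/

namespace ScCarrier

variable {α : Type} [DecidableEq α] {w : Multiset α}

/-- The element `0` of `S_c(w)`. -/
def zero : ScCarrier w := none

/-- The element of `S_c(w)` given by a word; it is `0` if the word is not a nonempty subword. -/
def ofWord (p : Multiset α) : ScCarrier w :=
  if h : p ≠ 0 ∧ p ≤ w then some ⟨p, h⟩ else none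

theorem ofWord_of_not_le {p : Multiset α} (h : ¬ p ≤ w) : (ofWord p : ScCarrier w) = zero :=
  dif_neg fun h' => h h'.2

theorem ofWord_of_le {p : Multiset α} (h : p ≠ 0 ∧ p ≤ w) :
    (ofWord p : ScCarrier w) = id (α := ScCarrier w) (some ⟨p, h⟩) := dif_pos h

theorem ofWord_inj {p q : Multiset α} (h0 : p ≠ 0) (hp : p ≤ w)
    (h : (ofWord p : ScCarrier w) = ofWord q) : p = q := by
  rw [ofWord_of_le ⟨h0, hp⟩] at h
  by_cases hq : q ≠ 0 ∧ q ≤ w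
  · rw [ofWord_of_le hq] at h
    exact congrArg Subtype.val (Option.some_injective _ h)
  · exact nomatch h.trans (dif_neg hq)

theorem ofWord_ne_zero {p : Multiset α} (h0 : p ≠ 0) (hp : p ≤ w) :
    (ofWord p : ScCarrier w) ≠ zero := by
  rw [ofWord_of_le ⟨h0, hp⟩]
  exact fun h => nomatch h

theorem eq_zero_or_ofWord (x : ScCarrier w) : x = zero ∨ ∃ p, p ≠ 0 ∧ p ≤ w ∧ x = ofWord p := by
  rcases x with _ | ⟨p, h⟩
  · exact Or.inl rfl
  · exact Or.inr ⟨p, h.1, h.2, (ofWord_of_le h).symm⟩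

theorem add_def (x y : ScCarrier w) : x + y = if x = y then x else zero := rfl

theorem zero_mul (x : ScCarrier w) : zero * x = zero := rfl

theorem mul_zero (x : ScCarrier w) : x * zero = zero := by cases x <;> rfl

theorem ofWord_mul {p q : Multiset α} (hp : p ≠ 0) (hq : q ≠ 0) :
    (ofWord p * ofWord q : ScCarrier w) = ofWord (p + q) := by
  by_cases h : p + q ≤ w
  · have h1 : p ≤ w := (Multiset.le_add_right p q).trans h
    have h2 : q ≤ w := (Multiset.le_add_left q p).trans h
    have h0 : p + q ≠ 0 := fun h0 => hp (add_eq_zero.1 h0).1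
    rw [ofWord_of_le ⟨hp, h1⟩, ofWord_of_le ⟨hq, h2⟩, ofWord_of_le ⟨h0, h⟩]
    exact dif_pos h
  · rw [ofWord_of_not_le h]
    by_cases h1 : p ≤ w
    · by_cases h2 : q ≤ w
      · rw [ofWord_of_le ⟨hp, h1⟩, ofWord_of_le ⟨hq, h2⟩]
        exact dif_neg h
      · rw [ofWord_of_not_le h2, mul_zero]
    · rw [ofWord_of_not_le h1, zero_mul]

end ScCarrier

/-! ### `S_c(abc)` lies in the variety generated by `S₇` -/

namespace S7Carrier

instance : DecidableEq S7Carrier := fun x y => by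
  cases x <;> cases y <;> first | exact isTrue rfl | exact isFalse (fun h => nomatch h)

instance : Fintype S7Carrier :=
  ⟨{inf, a, one}, fun x => by cases x <;> simp⟩

end S7Carrier

open S7Carrier in
/-- The triples over `S₇` other than the identity `(1, 1, 1)`. -/
def S7Cube : Alg.{0} where
  carrier := {f : Fin 3 → S7Carrier // f ≠ fun _ => one}
  instAdd := ⟨fun f g => ⟨fun i => f.1 i + g.1 i, by
    -- A sum or product in S₇ equals 1 only if both arguments do, so the complement of (1, 1, 1) is
    -- closed.
    have key : ∀ x y : S7Carrier, x + y = one → x = one := by decide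
    exact fun h => f.2 (funext fun i => key _ _ (congrFun h i))⟩⟩
  instMul := ⟨fun f g => ⟨fun i => f.1 i * g.1 i, by
    have key : ∀ x y : S7Carrier, x * y = one → x = one := by decide
    exact fun h => f.2 (funext fun i => key _ _ (congrFun h i))⟩⟩
  instNonempty := ⟨⟨fun _ => inf, fun h => nomatch congrFun h 0⟩⟩

namespace S7Cube

open S7Carrier

/-- The word formed by the letters at which a triple is `a`. -/
def word (f : Fin 3 → S7Carrier) : Multiset (Fin 3) := (Finset.univ.filter fun i => f i = a).val

theorem mem_word {f : Fin 3 → S7Carrier} {i : Fin 3} : i ∈ word f ↔ f i = a := by simp [word]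

theorem le_full_of_nodup {m : Multiset (Fin 3)} (h : m.Nodup) :
    m ≤ ({0, 1, 2} : Multiset (Fin 3)) :=
  (Multiset.le_iff_subset h).2 fun i _ => by fin_cases i <;> simp

theorem nodup_of_le_full {m : Multiset (Fin 3)} (h : m ≤ ({0, 1, 2} : Multiset (Fin 3))) :
    m.Nodup := Multiset.nodup_of_le h (by decide)

theorem word_ne_zero {f : Fin 3 → S7Carrier} (hf : f ≠ fun _ => one) (h : ∀ i, f i ≠ inf) :
    word f ≠ 0 := by
  intro h0
  apply hf
  funext i
  have h1 : f i ≠ a := fun hi => by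
    have := mem_word.2 hi
    rw [h0] at this
    exact Multiset.notMem_zero _ this
  have h2 := h i
  revert h1 h2
  generalize f i = y
  cases y <;> simp

theorem word_injective {f g : Fin 3 → S7Carrier} (hf : ∀ i, f i ≠ inf) (hg : ∀ i, g i ≠ inf)
    (h : word f = word g) : f = g := by
  funext i
  have h1 : f i = a ↔ g i = a := by rw [← mem_word, h, mem_word]
  have h2 := hf i
  have h3 := hg i
  revert h1 h2 h3
  generalize f i = x
  generalize g i = y
  cases x <;> cases y <;> simp

/-- The word of a triple, or `0` if some entry is `∞`. -/
def toScABC (f : {f : Fin 3 → S7Carrier // f ≠ fun _ => one}) :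
    ScCarrier ({0, 1, 2} : Multiset (Fin 3)) :=
  if ∀ i, f.1 i ≠ inf then .ofWord (word f.1) else .zero

/-- Triples without ∞ correspond to sets of letters, and a · a = ∞ matches the vanishing of words
with a repeated letter. Distinct triples have a sum with some entry ∞, which is flat addition. The
triple (1, 1, 1) has to be left out since it would give the empty word. -/
theorem isHom_toScABC : Alg.IsHom (A := S7Cube) (B := ScABC) toScABC := by
  have keyAdd : ∀ x y : S7Carrier, x + y ≠ inf → x = y := by decide
  have keyIdem : ∀ x : S7Carrier, x + x = x := by decide
  have keyMul : ∀ x y : S7Carrier, x * y ≠ inf ↔ x ≠ inf ∧ y ≠ inf ∧ ¬ (x = a ∧ y = a) := by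
    decide
  have keyMulA : ∀ x y : S7Carrier, x * y ≠ inf → (x * y = a ↔ x = a ∨ y = a) := by decide
  constructor
  · rintro ⟨f, hf⟩ ⟨g, hg⟩
    change toScABC ⟨fun i => f i + g i, _⟩ =
      (toScABC ⟨f, hf⟩ + toScABC ⟨g, hg⟩ : ScCarrier ({0, 1, 2} : Multiset (Fin 3)))
    rw [ScCarrier.add_def]
    by_cases hfg : f = g
    · subst hfg
      rw [if_pos rfl]
      congr 2
      exact funext fun i => keyIdem _
    · have h1 : ¬ ∀ i, f i + g i ≠ inf := fun h => hfg (funext fun i => keyAdd _ _ (h i))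
      unfold toScABC
      rw [if_neg h1]
      by_cases h2 : ∀ i, f i ≠ inf
      · by_cases h3 : ∀ i, g i ≠ inf
        · rw [if_pos h2, if_pos h3, if_neg]
          exact fun h => hfg (word_injective h2 h3
            (ScCarrier.ofWord_inj (word_ne_zero hf h2) (le_full_of_nodup (Finset.nodup _)) h))
        · rw [if_pos h2, if_neg h3, if_neg]
          exact ScCarrier.ofWord_ne_zero (word_ne_zero hf h2) (le_full_of_nodup (Finset.nodup _))
      · rw [if_neg h2, ite_self]
  · rintro ⟨f, hf⟩ ⟨g, hg⟩
    change toScABC ⟨fun i => f i * g i, _⟩ =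
      (toScABC ⟨f, hf⟩ * toScABC ⟨g, hg⟩ : ScCarrier ({0, 1, 2} : Multiset (Fin 3)))
    unfold toScABC
    by_cases h1 : ∀ i, f i ≠ inf
    · by_cases h2 : ∀ i, g i ≠ inf
      · rw [if_pos h1, if_pos h2, ScCarrier.ofWord_mul (word_ne_zero hf h1) (word_ne_zero hg h2)]
        by_cases h3 : ∀ i, f i * g i ≠ inf
        · rw [if_pos h3]
          have hd : (word f + word g).Nodup := by
            refine Multiset.nodup_add.2 ⟨Finset.nodup _, Finset.nodup _, ?_⟩
            rw [Multiset.disjoint_left]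
            intro i hi hi'
            exact ((keyMul _ _).1 (h3 i)).2.2 ⟨mem_word.1 hi, mem_word.1 hi'⟩
          congr 1
          refine (Multiset.Nodup.ext (Finset.nodup _) hd).2 fun i => ?_
          exact mem_word.trans ((keyMulA _ _ (h3 i)).trans
            (by rw [Multiset.mem_add, mem_word, mem_word]))
        · rw [if_neg h3, ScCarrier.ofWord_of_not_le]
          intro h4
          apply h3
          intro i
          refine (keyMul _ _).2 ⟨h1 i, h2 i, fun h => ?_⟩
          exact Multiset.disjoint_left.1 (Multiset.nodup_add.1 (nodup_of_le_full h4)).2.2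
            (mem_word.2 h.1) (mem_word.2 h.2)
      · have h3 : ¬ ∀ i, f i * g i ≠ inf := fun h => h2 fun i => ((keyMul _ _).1 (h i)).2.1
        rw [if_neg h2, if_neg h3, ScCarrier.mul_zero]
    · have h3 : ¬ ∀ i, f i * g i ≠ inf := fun h => h1 fun i => ((keyMul _ _).1 (h i)).1
      rw [if_neg h1, if_neg h3, ScCarrier.zero_mul]

theorem surjective_toScABC : Function.Surjective toScABC := by
  intro x
  rcases x.eq_zero_or_ofWord with rfl | ⟨m, hm0, hm, rfl⟩
  · exact ⟨⟨fun _ => inf, fun h => nomatch congrFun h 0⟩, if_neg fun h => h 0 rfl⟩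
  · obtain ⟨i, hi⟩ := Multiset.exists_mem_of_ne_zero hm0
    refine ⟨⟨fun i => if i ∈ m then a else one, fun h => ?_⟩, ?_⟩
    · have := congrFun h i
      simp [hi] at this
    · have h1 : ∀ i, (if i ∈ m then a else one) ≠ inf := fun i => by split_ifs <;> simp
      unfold toScABC
      rw [if_pos h1]
      congr 1
      refine (Multiset.Nodup.ext (Finset.nodup _) (nodup_of_le_full hm)).2 fun i => ?_
      refine mem_word.trans ?_
      by_cases h : i ∈ m <;> simp [h]

end S7Cube

theorem ScABC_mem_of_S7_mem {V : Set Alg.{u}} (hV : IsVariety V) (h : S7.lift ∈ V) :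
    ScABC.lift ∈ V := by
  have h1 : S7Cube.lift.{u} ∈ V := by
    refine hV.sub (Alg.pi fun _ : ULift.{u} (Fin 3) => S7.lift) _
      (fun f i => ULift.up (f.down.1 i.down)) ⟨fun _ _ => rfl, fun _ _ => rfl⟩ ?_
      (hV.prod _ _ fun _ => h)
    intro f g hfg
    refine ULift.down_injective (Subtype.ext (funext fun i => ?_))
    exact congrArg ULift.down (congrFun hfg ⟨i⟩)
  refine hV.image S7Cube.lift _ (fun f => ULift.up (S7Cube.toScABC f.down)) ⟨?_, ?_⟩ ?_ h1
  · exact fun x y => congrArg ULift.up (S7Cube.isHom_toScABC.1 x.down y.down)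
  · exact fun x y => congrArg ULift.up (S7Cube.isHom_toScABC.2 x.down y.down)
  · rintro ⟨y⟩
    obtain ⟨x, rfl⟩ := S7Cube.surjective_toScABC y
    exact ⟨⟨x⟩, rfl⟩

/-! ### A strip of triples with many colourings -/

/-- The four kinds of vertices in a column of the strip. -/
inductive Kind : Type
  | d
  | x
  | y
  | z
  deriving DecidableEq

instance : Fintype Kind := ⟨{.d, .x, .y, .z}, fun k => by cases k <;> simp⟩

/-- The hyperedges of the strip whose columns are indexed by `R`. -/
def stripEdges (R : Type) [CommRing R] : Set (Multiset (Kind × R)) :=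
  {e | ∃ i : R, e = {(.d, i), (.d, i + 1), (.x, i)} ∨ e = {(.d, i), (.y, i + 1), (.z, i - 2)} ∨
    e = {(.x, i), (.y, i), (.z, i)}}

theorem stripEdges_shift {M : ℕ} (c : ZMod M) {e : Multiset (Kind × ℤ)} (he : e ∈ stripEdges ℤ) :
    e.map (fun v => (v.1, (v.2 : ZMod M) + c)) ∈ stripEdges (ZMod M) := by
  obtain ⟨i, rfl | rfl | rfl⟩ := he
  · exact ⟨i + c, Or.inl (by simp [add_right_comm])⟩
  · exact ⟨i + c, Or.inr (Or.inl (by simp [add_right_comm, sub_add_eq_add_sub]))⟩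
  · exact ⟨i + c, Or.inr (Or.inr (by simp))⟩

/-- The colour of an integer: its residue modulo `3`. -/
def residue (n : ℤ) : Fin 3 := ⟨(n % 3).toNat, by omega⟩

theorem residue_eq_iff {m n : ℤ} : residue m = residue n ↔ m % 3 = n % 3 := by
  simp only [residue, Fin.mk.injEq]
  omega

theorem rainbow_iff {a b c : Fin 3} :
    ({a, b, c} : Multiset (Fin 3)) = {0, 1, 2} ↔ a ≠ b ∧ a ≠ c ∧ b ≠ c := by
  revert a b c
  decide

/-- A colouring of the vertices of the infinite strip for which all hyperedges are rainbow. -/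
structure IsStripColouring (κ : Kind → ℤ → ℤ) : Prop where
  top : ∀ i, κ .d i % 3 ≠ κ .d (i + 1) % 3 ∧ κ .d i % 3 ≠ κ .x i % 3 ∧
    κ .d (i + 1) % 3 ≠ κ .x i % 3
  diag : ∀ i, κ .d i % 3 ≠ κ .y (i + 1) % 3 ∧ κ .d i % 3 ≠ κ .z (i - 2) % 3 ∧
    κ .y (i + 1) % 3 ≠ κ .z (i - 2) % 3
  col : ∀ i, κ .x i % 3 ≠ κ .y i % 3 ∧ κ .x i % 3 ≠ κ .z i % 3 ∧ κ .y i % 3 ≠ κ .z i % 3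

theorem IsStripColouring.map_eq {κ : Kind → ℤ → ℤ} (hκ : IsStripColouring κ)
    {e : Multiset (Kind × ℤ)} (he : e ∈ stripEdges ℤ) :
    e.map (fun v => residue (κ v.1 v.2)) = {0, 1, 2} := by
  obtain ⟨i, rfl | rfl | rfl⟩ := he
  · exact rainbow_iff.2 (by simpa [residue_eq_iff] using hκ.top i)
  · exact rainbow_iff.2 (by simpa [residue_eq_iff] using hκ.diag i)
  · exact rainbow_iff.2 (by simpa [residue_eq_iff] using hκ.col i)

/-- The periodic colouring of the strip, modified near the columns `p` and `q`. -/
def flipColouring (p q : ℤ) : Kind → ℤ → ℤ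
  | .d, i => i + (if i = p ∨ i = q then 1 else 0) - (if i - 1 = p ∨ i - 1 = q then 1 else 0)
  | .x, i => i + 2 + (if i - 1 = p ∨ i - 1 = q then 1 else 0) -
      (if i + 1 = p ∨ i + 1 = q then 1 else 0)
  | .y, i => i - (if i - 1 = p ∨ i - 1 = q then 1 else 0)
  | .z, i => i + 1 + (if i + 1 = p ∨ i + 1 = q then 1 else 0)

/-- The mirror image of the periodic colouring of the strip. -/
def mirrorColouring : Kind → ℤ → ℤ
  | .d, i => i
  | .x, i => i + 2
  | .y, i => i + 1
  | .z, i => i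

/-- A flip at p exchanges the colours of d at p and p + 1. This is compensated by x at p - 1 and p +
1, y at p + 1 and z at p - 1, and nothing else moves. Two flips at distance at least 3 do not
interfere. -/
theorem isStripColouring_flip {p q : ℤ} (h : p = q ∨ p + 3 ≤ q ∨ q + 3 ≤ p) :
    IsStripColouring (flipColouring p q) := by
  constructor <;> intro i <;> simp only [flipColouring] <;> refine ⟨?_, ?_, ?_⟩ <;> split_ifs <;>
    omega

theorem isStripColouring_mirror : IsStripColouring mirrorColouring := by
  constructor <;> intro i <;> simp only [mirrorColouring] <;> omega

/-- Two vertices of the infinite strip lie in a common hyperedge. -/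
def StripAdj : Kind → ℤ → Kind → ℤ → Prop
  | .d, i, .d, j => i = j + 1 ∨ j = i + 1
  | .d, i, .x, j => j = i ∨ i = j + 1
  | .x, j, .d, i => j = i ∨ i = j + 1
  | .d, i, .y, j => j = i + 1
  | .y, j, .d, i => j = i + 1
  | .d, i, .z, j => i = j + 2
  | .z, j, .d, i => i = j + 2
  | .x, i, .y, j => i = j
  | .y, i, .x, j => i = j
  | .x, i, .z, j => i = j
  | .z, i, .x, j => i = j
  | .y, i, .z, j => i = j ∨ i = j + 3
  | .z, j, .y, i => i = j ∨ i = j + 3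
  | .x, _, .x, _ => False
  | .y, _, .y, _ => False
  | .z, _, .z, _ => False

/-- Vertices without a common hyperedge share their colour in some colouring. -/
theorem exists_colouring_eq {s t : Kind} {i j : ℤ} (h : ¬ StripAdj s i t j) :
    ∃ κ, IsStripColouring κ ∧ κ s i % 3 = κ t j % 3 := by
  have flip : ∀ p, flipColouring p p s i % 3 = flipColouring p p t j % 3 →
      ∃ κ, IsStripColouring κ ∧ κ s i % 3 = κ t j % 3 :=
    fun p hp => ⟨_, isStripColouring_flip (Or.inl rfl), hp⟩
  have flip₂ : ∀ p q, (p + 3 ≤ q ∨ q + 3 ≤ p) →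
      flipColouring p q s i % 3 = flipColouring p q t j % 3 →
      ∃ κ, IsStripColouring κ ∧ κ s i % 3 = κ t j % 3 :=
    fun p q hpq hp => ⟨_, isStripColouring_flip (Or.inr hpq), hp⟩
  have hr : (i - j) % 3 = 0 ∨ (i - j) % 3 = 1 ∨ (i - j) % 3 = 2 := by omega
  -- For most pairs of kinds one flip suffices, at a column depending on the residue of i - j: it
  -- moves exactly the vertices needed to close the gap between the two periodic colours.
  have single : ∀ p₀ p₁ p₂ : ℤ,
      ((i - j) % 3 = 0 → flipColouring p₀ p₀ s i % 3 = flipColouring p₀ p₀ t j % 3) →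
      ((i - j) % 3 = 1 → flipColouring p₁ p₁ s i % 3 = flipColouring p₁ p₁ t j % 3) →
      ((i - j) % 3 = 2 → flipColouring p₂ p₂ s i % 3 = flipColouring p₂ p₂ t j % 3) →
      ∃ κ, IsStripColouring κ ∧ κ s i % 3 = κ t j % 3 := by
    intro p₀ p₁ p₂ h₀ h₁ h₂
    rcases hr with h' | h' | h'
    exacts [flip _ (h₀ h'), flip _ (h₁ h'), flip _ (h₂ h')]
  cases s <;> cases t <;> simp only [StripAdj] at h
  · refine single (i - 2) (i - 1) (i) ?_ ?_ ?_ <;> intro <;>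
      simp only [flipColouring, or_self, if_true] <;> split_ifs <;> omega
  · refine single (i - 1) (i) (i - 2) ?_ ?_ ?_ <;> intro <;>
      simp only [flipColouring, or_self, if_true] <;> split_ifs <;> omega
  · refine single (i - 2) (i - 1) (i) ?_ ?_ ?_ <;> intro <;>
      simp only [flipColouring, or_self, if_true] <;> split_ifs <;> omega
  · refine single (i) (i - 2) (i - 1) ?_ ?_ ?_ <;> intro <;>
      simp only [flipColouring, or_self, if_true] <;> split_ifs <;> omega
  · refine single (j - 1) (j - 2) (j) ?_ ?_ ?_ <;> intro <;>
      simp only [flipColouring, or_self, if_true] <;> split_ifs <;> omega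
  · rcases hr with h' | h' | h'
    · exact flip i (by simp only [flipColouring, or_self]; split_ifs <;> omega)
    -- The flip at i + 1 moves x at i by the required amount. If j = i + 2 it would move x at j too,
    -- so flips on the outer sides of both columns replace it.
    · by_cases hj : j = i + 2
      · exact flip₂ (i - 1) (i + 3) (by omega)
          (by simp only [flipColouring, true_or, if_true]; split_ifs <;> omega)
      · exact flip (i + 1) (by simp only [flipColouring, or_self, if_true]; split_ifs <;> omega)
    · by_cases hi : i = j + 2
      · exact flip₂ (j - 1) (j + 3) (by omega)
          (by simp only [flipColouring, true_or, if_true]; split_ifs <;> omega)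
      · exact flip (j + 1) (by simp only [flipColouring, or_self, if_true]; split_ifs <;> omega)
  · refine single (i - 1) (i) (i + 1) ?_ ?_ ?_ <;> intro <;>
      simp only [flipColouring, or_self, if_true] <;> split_ifs <;> omega
  · refine single (i + 1) (i - 1) (i - 2) ?_ ?_ ?_ <;> intro <;>
      simp only [flipColouring, or_self, if_true] <;> split_ifs <;> omega
  · refine single (j - 2) (j) (j - 1) ?_ ?_ ?_ <;> intro <;>
      simp only [flipColouring, or_self, if_true] <;> split_ifs <;> omega
  · refine single (j - 1) (j + 1) (j) ?_ ?_ ?_ <;> intro <;>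
      simp only [flipColouring, or_self, if_true] <;> split_ifs <;> omega
  · refine single (i) (i - 1) (j - 1) ?_ ?_ ?_ <;> intro <;>
      simp only [flipColouring, or_self, if_true] <;> split_ifs <;> omega
  · rcases hr with h' | h' | h'
    -- Both vertices have to move. Nonadjacency excludes i - j = 0 and i - j = 3, so these two flips
    -- are far enough apart.
    · exact flip₂ (i - 1) (j + 1) (by omega)
        (by simp only [flipColouring, true_or, or_true, if_true]; omega)
    · exact flip (i - 2) (by simp only [flipColouring, or_self]; split_ifs <;> omega)
    -- Exactly one of the two vertices would have to move, but for i = j + 2 every flip moves both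
    -- or neither. The mirror colouring covers the whole residue class.
    · exact ⟨_, isStripColouring_mirror, by simp only [mirrorColouring]; omega⟩
  · refine single (j) (j - 1) (j - 2) ?_ ?_ ?_ <;> intro <;>
      simp only [flipColouring, or_self, if_true] <;> split_ifs <;> omega
  · refine single (j + 1) (j - 2) (j - 1) ?_ ?_ ?_ <;> intro <;>
      simp only [flipColouring, or_self, if_true] <;> split_ifs <;> omega
  · rcases hr with h' | h' | h'
    · exact flip₂ (j - 1) (i + 1) (by omega)
        (by simp only [flipColouring, true_or, or_true, if_true]; omega)
    · exact ⟨_, isStripColouring_mirror, by simp only [mirrorColouring]; omega⟩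
    · exact flip (j - 2) (by simp only [flipColouring, or_self]; split_ifs <;> omega)
  · refine single (i) (j + 1) (i + 1) ?_ ?_ ?_ <;> intro <;>
      simp only [flipColouring, or_self, if_true] <;> split_ifs <;> omega

/-- The adjacency graph has no triangles besides the hyperedges, so hyperedges can be recognised
from pairs of vertices. The case check tries every order of the three vertices. -/
theorem mem_stripEdges_of_adj {u v w : Kind × ℤ} (huv : StripAdj u.1 u.2 v.1 v.2)
    (huw : StripAdj u.1 u.2 w.1 w.2) (hvw : StripAdj v.1 v.2 w.1 w.2) :
    ({u, v, w} : Multiset (Kind × ℤ)) ∈ stripEdges ℤ := by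
  obtain ⟨s, i⟩ := u
  obtain ⟨t, j⟩ := v
  obtain ⟨r, k⟩ := w
  have swap₁ : ∀ a b c : Kind × ℤ, ({a, b, c} : Multiset (Kind × ℤ)) = {b, a, c} :=
    fun a b c => Multiset.cons_swap a b {c}
  have swap₂ : ∀ a b c : Kind × ℤ, ({a, b, c} : Multiset (Kind × ℤ)) = {a, c, b} :=
    fun a b c => congrArg (Multiset.cons a) (Multiset.pair_comm b c)
  have top : ∀ i j k : ℤ, (j = i + 1 ∧ k = i ∨ i = j + 1 ∧ k = j) →
      ({(.d, i), (.d, j), (.x, k)} : Multiset (Kind × ℤ)) ∈ stripEdges ℤ := by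
    rintro i j k (⟨rfl, rfl⟩ | ⟨rfl, rfl⟩)
    · exact ⟨_, Or.inl rfl⟩
    · exact ⟨_, Or.inl (swap₁ _ _ _)⟩
  have diag : ∀ i j k : ℤ, j = i + 1 → k = i - 2 →
      ({(.d, i), (.y, j), (.z, k)} : Multiset (Kind × ℤ)) ∈ stripEdges ℤ := by
    rintro i j k rfl rfl
    exact ⟨_, Or.inr (Or.inl rfl)⟩
  have col : ∀ i j k : ℤ, i = j → i = k →
      ({(.x, i), (.y, j), (.z, k)} : Multiset (Kind × ℤ)) ∈ stripEdges ℤ := by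
    rintro i j k rfl rfl
    exact ⟨_, Or.inr (Or.inr rfl)⟩
  cases s <;> cases t <;> cases r <;> simp only [StripAdj] at huv huw hvw <;> first
    | omega
    | exact top _ _ _ (by omega)
    | exact swap₂ _ _ _ ▸ top _ _ _ (by omega)
    | exact swap₁ _ _ _ ▸ swap₂ _ _ _ ▸ top _ _ _ (by omega)
    | exact diag _ _ _ (by omega) (by omega)
    | exact swap₁ _ _ _ ▸ diag _ _ _ (by omega) (by omega)
    | exact swap₂ _ _ _ ▸ diag _ _ _ (by omega) (by omega)
    | exact swap₁ _ _ _ ▸ swap₂ _ _ _ ▸ diag _ _ _ (by omega) (by omega)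
    | exact swap₂ _ _ _ ▸ swap₁ _ _ _ ▸ diag _ _ _ (by omega) (by omega)
    | exact swap₁ _ _ _ ▸ swap₂ _ _ _ ▸ swap₁ _ _ _ ▸ diag _ _ _ (by omega) (by omega)
    | exact col _ _ _ (by omega) (by omega)
    | exact swap₁ _ _ _ ▸ col _ _ _ (by omega) (by omega)
    | exact swap₂ _ _ _ ▸ col _ _ _ (by omega) (by omega)
    | exact swap₁ _ _ _ ▸ swap₂ _ _ _ ▸ col _ _ _ (by omega) (by omega)
    | exact swap₂ _ _ _ ▸ swap₁ _ _ _ ▸ col _ _ _ (by omega) (by omega)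
    | exact swap₁ _ _ _ ▸ swap₂ _ _ _ ▸ swap₁ _ _ _ ▸ col _ _ _ (by omega) (by omega)

/-! ### Cutting the cyclic strip open -/

/-- A small set of vertices of the cyclic strip avoids two consecutive columns. -/
theorem exists_unused_columns {M : ℕ} [NeZero M] (W : Finset (Kind × ZMod M))
    (hW : 2 * W.card < M) : ∃ c : ZMod M, ∀ v ∈ W, v.2 - c ≠ 0 ∧ v.2 - c ≠ 1 := by
  -- These are the columns c for which c or c + 1 is occupied.
  have h1 : (W.image Prod.snd ∪ W.image fun v => v.2 - 1).card < Fintype.card (ZMod M) := by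
    rw [ZMod.card]
    refine lt_of_le_of_lt (Finset.card_union_le _ _) (lt_of_le_of_lt ?_ hW)
    rw [two_mul]
    exact add_le_add Finset.card_image_le Finset.card_image_le
  obtain ⟨c, hc⟩ : ∃ c, c ∉ W.image Prod.snd ∪ W.image fun v => v.2 - 1 := by
    by_contra! h
    rw [Finset.eq_univ_of_forall h, Finset.card_univ] at h1
    exact lt_irrefl _ h1
  refine ⟨c, fun v hv => ⟨fun h => hc ?_, fun h => hc ?_⟩⟩
  · exact Finset.mem_union_left _ (Finset.mem_image.2 ⟨v, hv, sub_eq_zero.1 h⟩)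
  · exact Finset.mem_union_right _ (Finset.mem_image.2 ⟨v, hv, by rw [← h]; ring⟩)

theorem ZMod.val_add_one_cast {M : ℕ} [NeZero M] (a : ZMod M) (h : a + 1 ≠ 0) :
    ((a + 1).val : ℤ) = a.val + 1 := by
  have h1 : a.val + 1 ≠ M := fun h1 => h (by
    rw [← ZMod.natCast_zmod_val a, ← Nat.cast_one (R := ZMod M), ← Nat.cast_add, h1]
    exact ZMod.natCast_self M)
  have h2 := ZMod.val_lt a
  rw [ZMod.val_add, ZMod.val_one_eq_one_mod, Nat.add_mod_mod, Nat.mod_eq_of_lt (by omega)]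
  push_cast
  rfl

/-- A hyperedge of the cyclic strip avoiding the columns `c` and `c + 1` lifts to the infinite
strip. -/
theorem lift_mem_stripEdges {M : ℕ} [NeZero M] {c : ZMod M} {e : Multiset (Kind × ZMod M)}
    (he : e ∈ stripEdges (ZMod M)) (hc : ∀ v ∈ e, v.2 - c ≠ 0 ∧ v.2 - c ≠ 1) :
    e.map (fun v => (v.1, ((v.2 - c).val : ℤ))) ∈ stripEdges ℤ := by
  have shift : ∀ a : ZMod M, a + 1 - c ≠ 0 → ((a + 1 - c).val : ℤ) = (a - c).val + 1 := by
    intro a ha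
    rw [add_sub_right_comm] at ha ⊢
    exact ZMod.val_add_one_cast _ ha
  obtain ⟨i, rfl | rfl | rfl⟩ := he
  · refine ⟨(i - c).val, Or.inl ?_⟩
    have h := shift i (hc (.d, i + 1) (by simp)).1
    rw [← h]
    rfl
  · refine ⟨(i - c).val, Or.inr (Or.inl ?_)⟩
    have h := shift i (hc (.y, i + 1) (by simp)).1
    have hi := hc (.d, i) (by simp)
    have h1 := shift (i - 1) (by simpa using hi.1)
    -- Column i - 1 carries no vertex of this hyperedge, so avoiding c alone would not prevent a
    -- wrap-around between i - 2 and i. Avoiding c + 1 rules out i - 1 = c.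
    have h2 := shift (i - 2) (by
      intro h0
      exact hi.2 (by linear_combination h0))
    rw [sub_add_cancel] at h1
    rw [show i - 2 + 1 = i - 1 by ring] at h2
    have h3 : ((i - 2 - c).val : ℤ) = (i - c).val - 2 := by omega
    rw [← h, ← h3]
    rfl
  · exact ⟨(i - c).val, Or.inr (Or.inr (by simp))⟩

/-- Small parts of the cyclic strip have so many rainbow colourings that the words which are
always rainbow are hyperedges. -/
theorem mem_stripEdges_of_forall_colouring {M : ℕ} [NeZero M] (W : Finset (Kind × ZMod M))
    (hW : 2 * W.card < M) (e : Multiset (Kind × ZMod M))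
    (he : ∀ κ : Kind × ZMod M → Fin 3,
      (∀ f ∈ stripEdges (ZMod M), (∀ v ∈ f, v ∈ W) → f.map κ = {0, 1, 2}) →
        (∀ v ∈ e, v ∈ W) ∧ e.map κ = {0, 1, 2}) : e ∈ stripEdges (ZMod M) := by
  obtain ⟨c, hc⟩ := exists_unused_columns W hW
  have key : ∀ κ, IsStripColouring κ → (∀ v ∈ e, v ∈ W) ∧
      e.map (fun v => residue (κ v.1 ((v.2 - c).val : ℤ))) = {0, 1, 2} := by
    intro κ hκ
    apply he
    intro f hf hfW
    have := hκ.map_eq (lift_mem_stripEdges hf fun v hv => hc v (hfW v hv))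
    rwa [Multiset.map_map] at this
  have h0 := (key _ (isStripColouring_flip (p := 0) (q := 0) (Or.inl rfl))).2
  have hcard : e.card = 3 := by
    have := congrArg Multiset.card h0
    simpa using this
  obtain ⟨u, v, w, rfl⟩ := Multiset.card_eq_three.1 hcard
  have key' : ∀ κ, IsStripColouring κ → _ := fun κ hκ => rainbow_iff.1 (key κ hκ).2
  simp only [ne_eq, residue_eq_iff] at key'
  have h1 : ({(u.1, ((u.2 - c).val : ℤ)), (v.1, ((v.2 - c).val : ℤ)),
      (w.1, ((w.2 - c).val : ℤ))} : Multiset (Kind × ℤ)) ∈ stripEdges ℤ := by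
    -- A nonadjacent pair would receive equal colours in some colouring, which is then not rainbow
    -- on the word.
    apply mem_stripEdges_of_adj
    · by_contra h
      obtain ⟨κ, hκ, h'⟩ := exists_colouring_eq h
      exact (key' κ hκ).1 h'
    · by_contra h
      obtain ⟨κ, hκ, h'⟩ := exists_colouring_eq h
      exact (key' κ hκ).2.1 h'
    · by_contra h
      obtain ⟨κ, hκ, h'⟩ := exists_colouring_eq h
      exact (key' κ hκ).2.2 h'
  have h2 := stripEdges_shift c h1
  simpa using h2

theorem card_of_mem_stripEdges {R : Type} [CommRing R] {e : Multiset (Kind × R)}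
    (he : e ∈ stripEdges R) : e.card = 3 := by
  obtain ⟨i, rfl | rfl | rfl⟩ := he <;> rfl

theorem nodup_of_mem_stripEdges {R : Type} [CommRing R] [Nontrivial R] {e : Multiset (Kind × R)}
    (he : e ∈ stripEdges R) : e.Nodup := by
  obtain ⟨i, rfl | rfl | rfl⟩ := he <;> simp

/-- No set of vertices of the cyclic strip of length `M` meets each hyperedge in exactly one
vertex unless `M` is divisible by three. -/
theorem three_dvd_of_exact_cover {M : ℕ} [NeZero M] (f : Kind × ZMod M → ℤ)
    (top : ∀ i, f (.d, i) + f (.d, i + 1) + f (.x, i) = 1)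
    (diag : ∀ i, f (.d, i) + f (.y, i + 1) + f (.z, i - 2) = 1)
    (col : ∀ i, f (.x, i) + f (.y, i) + f (.z, i) = 1) : 3 ∣ M := by
  have shift : ∀ (g : ZMod M → ℤ) (c : ZMod M), ∑ i, g (i + c) = ∑ i, g i :=
    fun g c => Equiv.sum_comp (Equiv.addRight c) g
  have h1 := Finset.sum_congr rfl fun i (_ : i ∈ Finset.univ) => top i
  have h2 := Finset.sum_congr rfl fun i (_ : i ∈ Finset.univ) => diag i
  have h3 := Finset.sum_congr rfl fun i (_ : i ∈ Finset.univ) => col i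
  simp only [sub_eq_add_neg, Finset.sum_add_distrib, Finset.sum_const, Finset.card_univ,
    ZMod.card, nsmul_eq_mul, mul_one, shift fun i => f (.d, i), shift fun i => f (.y, i),
    shift fun i => f (.z, i)] at h1 h2 h3
  -- With D, X, Y, Z the sums over the four kinds, 2D + X = D + Y + Z = X + Y + Z = M, so D = X and
  -- 3D = M.
  omega

/-! ### Monomials of terms -/

namespace Term

/-- The variables of a term. -/
def vars : Term → Finset ℕ
  | var n => {n}
  | add s t => s.vars ∪ t.vars
  | mul s t => s.vars ∪ t.vars

/-- The monomials of a term, as multisets of variables. -/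
def mons : Term → Set (Multiset ℕ)
  | var n => {{n}}
  | add s t => s.mons ∪ t.mons
  | mul s t => Set.image2 (· + ·) s.mons t.mons

theorem mons_nonempty (t : Term) : t.mons.Nonempty := by
  induction t with
  | var n => exact ⟨_, rfl⟩
  | add s t hs ht => exact hs.mono Set.subset_union_left
  | mul s t hs ht => exact hs.image2 ht

theorem ne_zero_of_mem_mons {t : Term} {m : Multiset ℕ} (hm : m ∈ t.mons) : m ≠ 0 := by
  induction t generalizing m with
  | var n =>
    obtain rfl : m = {n} := hm
    exact Multiset.singleton_ne_zero n
  | add s t hs ht => exact hm.elim hs ht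
  | mul s t hs ht =>
    obtain ⟨p, hp, q, hq, rfl⟩ := hm
    exact fun h => hs hp (add_eq_zero.1 h).1

theorem mem_vars_iff {t : Term} {n : ℕ} : n ∈ t.vars ↔ ∃ m ∈ t.mons, n ∈ m := by
  induction t with
  | var k => simp [vars, mons]
  | add s t hs ht =>
    simp only [vars, mons, Finset.mem_union, Set.mem_union, hs, ht, or_and_right, exists_or]
  | mul s t hs ht =>
    simp only [vars, mons, Finset.mem_union, hs, ht]
    constructor
    · rintro (⟨m, hm, hn⟩ | ⟨m, hm, hn⟩)
      · obtain ⟨q, hq⟩ := t.mons_nonempty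
        exact ⟨_, ⟨m, hm, q, hq, rfl⟩, Multiset.mem_add.2 (Or.inl hn)⟩
      · obtain ⟨q, hq⟩ := s.mons_nonempty
        exact ⟨_, ⟨q, hq, m, hm, rfl⟩, Multiset.mem_add.2 (Or.inr hn)⟩
    · rintro ⟨_, ⟨p, hp, q, hq, rfl⟩, hn⟩
      exact (Multiset.mem_add.1 hn).imp (fun h => ⟨p, hp, h⟩) (fun h => ⟨q, hq, h⟩)

end Term

/-! ### Evaluating terms in `S_c(w)` and transferring identities to the strip -/

theorem Multiset.bind_ne_zero {α β : Type*} {m : Multiset α} {τ : α → Multiset β} (hm : m ≠ 0)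
    (hτ : ∀ x, τ x ≠ 0) : m.bind τ ≠ 0 := by
  obtain ⟨a, ha⟩ := Multiset.exists_mem_of_ne_zero hm
  obtain ⟨b, hb⟩ := Multiset.exists_mem_of_ne_zero (hτ a)
  exact fun h => Multiset.notMem_zero b (h ▸ Multiset.mem_bind.2 ⟨a, ha, hb⟩)

theorem Multiset.le_bind_of_mem {α β : Type*} {m : Multiset α} (τ : α → Multiset β) {a : α}
    (ha : a ∈ m) : τ a ≤ m.bind τ := by
  obtain ⟨m, rfl⟩ := Multiset.exists_cons_of_mem ha
  rw [Multiset.cons_bind]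
  exact Multiset.le_add_right _ _

theorem ScCarrier.add_eq_ofWord_iff {α : Type} [DecidableEq α] {w : Multiset α}
    (x y : ScCarrier w) {c : Multiset α} (h0 : c ≠ 0) (hc : c ≤ w) :
    x + y = ScCarrier.ofWord c ↔ x = ScCarrier.ofWord c ∧ y = ScCarrier.ofWord c := by
  rw [ScCarrier.add_def]
  split_ifs with h
  · rw [← h, and_self_iff]
  · exact ⟨fun h' => absurd h'.symm (ScCarrier.ofWord_ne_zero h0 hc),
      fun h' => absurd (h'.1.trans h'.2.symm) h⟩

theorem ScCarrier.mul_eq_ofWord_iff {α : Type} [DecidableEq α] {w : Multiset α}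
    (x y : ScCarrier w) {c : Multiset α} (h0 : c ≠ 0) (hc : c ≤ w) :
    x * y = ScCarrier.ofWord c ↔ ∃ p q, p ≠ 0 ∧ q ≠ 0 ∧ p + q = c ∧
      x = ScCarrier.ofWord p ∧ y = ScCarrier.ofWord q := by
  constructor
  · intro h
    rcases x.eq_zero_or_ofWord with rfl | ⟨p, hp0, hp, rfl⟩
    · rw [ScCarrier.zero_mul] at h
      exact absurd h.symm (ScCarrier.ofWord_ne_zero h0 hc)
    rcases y.eq_zero_or_ofWord with rfl | ⟨q, hq0, hq, rfl⟩
    · rw [ScCarrier.mul_zero] at h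
      exact absurd h.symm (ScCarrier.ofWord_ne_zero h0 hc)
    rw [ScCarrier.ofWord_mul hp0 hq0] at h
    exact ⟨p, q, hp0, hq0, (ScCarrier.ofWord_inj h0 hc h.symm).symm, rfl, rfl⟩
  · rintro ⟨p, q, hp, hq, rfl, rfl, rfl⟩
    exact ScCarrier.ofWord_mul hp hq

/-- The value of a term in `S_c(w)` is a word exactly if all its monomials evaluate to this
word. -/
theorem eval_ofWord_eq_iff {α : Type} [DecidableEq α] {w : Multiset α} {ρ : ℕ → Multiset α}
    (hρ : ∀ n, ρ n ≠ 0) (t : Term) {c : Multiset α} (h0 : c ≠ 0) (hc : c ≤ w) :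
    t.eval (A := Sc w) (fun n => (ScCarrier.ofWord (ρ n) : ScCarrier w)) =
      (ScCarrier.ofWord c : ScCarrier w) ↔ ∀ m ∈ t.mons, m.bind ρ = c := by
  induction t generalizing c with
  | var n =>
    simp only [Term.mons, Set.mem_singleton_iff, forall_eq, Multiset.singleton_bind]
    exact ⟨fun h => (ScCarrier.ofWord_inj h0 hc h.symm).symm, fun h => h ▸ rfl⟩
  | add s t hs ht =>
    simp only [Term.mons, Set.mem_union, or_imp, forall_and, ← hs h0 hc, ← ht h0 hc]
    exact ScCarrier.add_eq_ofWord_iff _ _ h0 hc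
  | mul s t hs ht =>
    refine (ScCarrier.mul_eq_ofWord_iff _ _ h0 hc).trans ⟨?_, fun h => ?_⟩
    · rintro ⟨p, q, hp0, hq0, rfl, hx, hy⟩ _ ⟨m, hm, n, hn, rfl⟩
      exact (Multiset.add_bind _ _ _).trans (congrArg₂ _
        ((hs hp0 ((Multiset.le_add_right _ _).trans hc)).1 hx m hm)
        ((ht hq0 ((Multiset.le_add_left _ _).trans hc)).1 hy n hn))
    · have h' : ∀ m ∈ s.mons, ∀ n ∈ t.mons, m.bind ρ + n.bind ρ = c := fun m hm n hn => by
        rw [← Multiset.add_bind]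
        exact h _ ⟨m, hm, n, hn, rfl⟩
      -- Fixing one monomial in each factor and cancelling it shows that all monomials of the other
      -- factor have a common value.
      obtain ⟨m₀, hm₀⟩ := s.mons_nonempty
      obtain ⟨n₀, hn₀⟩ := t.mons_nonempty
      have hm0 : m₀.bind ρ ≠ 0 := Multiset.bind_ne_zero (Term.ne_zero_of_mem_mons hm₀) hρ
      have hn0 : n₀.bind ρ ≠ 0 := Multiset.bind_ne_zero (Term.ne_zero_of_mem_mons hn₀) hρ
      have h₀ := h' m₀ hm₀ n₀ hn₀
      exact ⟨_, _, hm0, hn0, h₀,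
        (hs hm0 ((Multiset.le_add_right _ _).trans (h₀.le.trans hc))).2 fun m hm =>
          add_right_cancel ((h' m hm n₀ hn₀).trans h₀.symm),
        (ht hn0 ((Multiset.le_add_left _ _).trans (h₀.le.trans hc))).2 fun n hn =>
          add_left_cancel ((h' m₀ hm₀ n hn).trans h₀.symm)⟩

/-- An identity of `S_c(abc)` in few variables preserves the property that all monomials become
hyperedges of a long cyclic strip. -/
theorem mem_stripEdges_of_satisfies {M : ℕ} [NeZero M] {s t : Term} (h : ScABC.Satisfies (s, t))
    (hM : 2 * (3 * s.vars.card + 3) < M) {τ : ℕ → Multiset (Kind × ZMod M)} (hτ : ∀ n, τ n ≠ 0)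
    {q : Multiset (Kind × ZMod M)} (hs : ∀ m ∈ s.mons, m.bind τ + q ∈ stripEdges (ZMod M)) :
    ∀ m ∈ t.mons, m.bind τ + q ∈ stripEdges (ZMod M) := by
  classical
  intro m hm
  obtain ⟨m₀, hm₀⟩ := s.mons_nonempty
  let W : Finset (Kind × ZMod M) := (s.vars.biUnion fun n => (τ n).toFinset) ∪ q.toFinset
  have hτc : ∀ n ∈ s.vars, (τ n).toFinset.card ≤ 3 := by
    intro n hn
    obtain ⟨m, hm, hnm⟩ := Term.mem_vars_iff.1 hn
    refine (Multiset.toFinset_card_le _).trans ?_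
    rw [← card_of_mem_stripEdges (hs m hm)]
    exact Multiset.card_le_card ((Multiset.le_bind_of_mem τ hnm).trans (Multiset.le_add_right _ _))
  have hqc : q.toFinset.card ≤ 3 := by
    refine (Multiset.toFinset_card_le _).trans ?_
    rw [← card_of_mem_stripEdges (hs m₀ hm₀)]
    exact Multiset.card_le_card (Multiset.le_add_left _ _)
  have hW : W.card ≤ 3 * s.vars.card + 3 := by
    refine (Finset.card_union_le _ _).trans (add_le_add ?_ hqc)
    rw [mul_comm]
    exact Finset.card_biUnion_le_card_mul _ _ _ hτc
  have hsW : ∀ m : Multiset ℕ, (∀ n ∈ m, n ∈ s.vars) → ∀ v ∈ m.bind τ + q, v ∈ W := by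
    intro m hm v hv
    rcases Multiset.mem_add.1 hv with hv | hv
    · obtain ⟨n, hn, hv⟩ := Multiset.mem_bind.1 hv
      exact Finset.mem_union_left _ (Finset.mem_biUnion.2
        ⟨n, hm n hn, Multiset.mem_toFinset.2 hv⟩)
    · exact Finset.mem_union_right _ (Multiset.mem_toFinset.2 hv)
  refine mem_stripEdges_of_forall_colouring W (by omega) _ fun κ hκ => ?_
  -- The default word has a repeated letter, so it divides no subword of abc. This forces every
  -- variable in a monomial of `t` to occur in `s`.
  let ρ : ℕ → Multiset (Fin 3) := fun n => if n ∈ s.vars then (τ n).map κ else {0, 0}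
  have hρ : ∀ n, ρ n ≠ 0 := by
    intro n
    by_cases hn : n ∈ s.vars
    · simp only [ρ, if_pos hn, ne_eq, Multiset.map_eq_zero]
      exact hτ n
    · simp only [ρ, if_neg hn]
      decide
  have hρτ : ∀ m : Multiset ℕ, (∀ n ∈ m, n ∈ s.vars) → m.bind ρ = (m.bind τ).map κ := by
    intro m hm
    rw [Multiset.map_bind]
    exact Multiset.bind_congr fun n hn => if_pos (hm n hn)
  have hmap : ∀ m ∈ s.mons, m.bind ρ + q.map κ = {0, 1, 2} := by
    intro m hm
    have hmv : ∀ n ∈ m, n ∈ s.vars := fun n hn => Term.mem_vars_iff.2 ⟨m, hm, hn⟩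
    rw [hρτ m hmv, ← Multiset.map_add]
    exact hκ _ (hs m hm) (hsW m hmv)
  have hc := hmap m₀ hm₀
  have hle : m₀.bind ρ ≤ ({0, 1, 2} : Multiset (Fin 3)) := hc ▸ Multiset.le_add_right _ _
  have h0 : m₀.bind ρ ≠ 0 := Multiset.bind_ne_zero (Term.ne_zero_of_mem_mons hm₀) hρ
  have hse := (eval_ofWord_eq_iff hρ s h0 hle).2 fun m hm =>
    add_right_cancel ((hmap m hm).trans hc.symm)
  have hte : m.bind ρ = m₀.bind ρ := (eval_ofWord_eq_iff hρ t h0 hle).1 ((h _).symm.trans hse) m hm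
  have hmv : ∀ n ∈ m, n ∈ s.vars := by
    intro n hn
    by_contra hns
    have h1 : ρ n ≤ ({0, 1, 2} : Multiset (Fin 3)) :=
      (Multiset.le_bind_of_mem ρ hn).trans (hte.le.trans hle)
    simp only [ρ, if_neg hns] at h1
    exact absurd h1 (by decide)
  refine ⟨hsW m hmv, ?_⟩
  rw [Multiset.map_add, ← hρτ m hmv, hte, hc]

/-! ### The syntactic algebra of a set of words -/

/-- The nonempty sets of nonempty commutative words over `α`. -/
structure WordSet (α : Type) where
  words : Set (Multiset α)
  nonempty : words.Nonempty
  zero_notMem : 0 ∉ words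

namespace WordSet

variable {α : Type}

theorem ne_zero_of_mem {P : WordSet α} {p : Multiset α} (hp : p ∈ P.words) : p ≠ 0 :=
  fun h => P.zero_notMem (h ▸ hp)

instance : Add (WordSet α) := ⟨fun P Q => ⟨P.words ∪ Q.words,
  P.nonempty.mono Set.subset_union_left, fun h => h.elim P.zero_notMem Q.zero_notMem⟩⟩

instance : Mul (WordSet α) := ⟨fun P Q => ⟨Set.image2 (· + ·) P.words Q.words,
  P.nonempty.image2 Q.nonempty, by
    rintro ⟨p, hp, q, -, h⟩
    exact ne_zero_of_mem hp (add_eq_zero.1 h).1⟩⟩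

/-- The one-element set of a one-letter word. -/
def letter (a : α) : WordSet α :=
  ⟨{{a}}, Set.singleton_nonempty _,
    fun h => Multiset.singleton_ne_zero _ (Set.mem_singleton_iff.1 h).symm⟩

instance [Nonempty α] : Nonempty (WordSet α) := ⟨letter (Classical.arbitrary α)⟩

theorem words_add (P Q : WordSet α) : (P + Q).words = P.words ∪ Q.words := rfl

theorem words_mul (P Q : WordSet α) : (P * Q).words = Set.image2 (· + ·) P.words Q.words := rfl

end WordSet

/-- The algebra of nonempty sets of nonempty commutative words, with union and product. -/
def setAlg (α : Type) [Nonempty α] : Alg.{0} where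
  carrier := WordSet α

/-- Two sets of words are equivalent if the same words complete all their elements to elements
of `E`. -/
def syntacticSetoid {α : Type} (E : Set (Multiset α)) : Setoid (WordSet α) where
  r P Q := ∀ q, (∀ p ∈ P.words, p + q ∈ E) ↔ ∀ p ∈ Q.words, p + q ∈ E
  iseqv := ⟨fun _ _ => Iff.rfl, fun h q => (h q).symm, fun h h' q => (h q).trans (h' q)⟩

/-- The quotient of the algebra of sets of words by the syntactic congruence of `E`. -/
def syntacticAlg {α : Type} [Nonempty α] (E : Set (Multiset α)) : Alg.{0} where
  carrier := Quotient (syntacticSetoid E)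
  instAdd := ⟨Quotient.map₂ (· + ·) (by
    intro P P' hP Q Q' hQ q
    simp only [WordSet.words_add, Set.mem_union, or_imp, forall_and]
    exact and_congr (hP q) (hQ q))⟩
  instMul := ⟨Quotient.map₂ (· * ·) (by
    intro P P' hP Q Q' hQ q
    -- A word of one factor can be moved into the context q, so the two factors are replaced one at
    -- a time.
    have left : ∀ R S : WordSet α, (∀ p ∈ (R * S).words, p + q ∈ E) ↔
        ∀ s ∈ S.words, ∀ r ∈ R.words, r + (s + q) ∈ E := by
      intro R S
      simp only [WordSet.words_mul, Set.forall_mem_image2, add_assoc]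
      exact ⟨fun h s hs r hr => h r hr s hs, fun h r hr s hs => h s hs r hr⟩
    have right : ∀ R S : WordSet α, (∀ p ∈ (R * S).words, p + q ∈ E) ↔
        ∀ r ∈ R.words, ∀ s ∈ S.words, s + (r + q) ∈ E := by
      intro R S
      simp only [WordSet.words_mul, Set.forall_mem_image2, add_assoc, add_left_comm]
    rw [left P Q, forall₂_congr fun s _ => hP (s + q), ← left P' Q, right P' Q,
      forall₂_congr fun r _ => hQ (r + q), ← right P' Q'])⟩
  instNonempty := (inferInstance : Nonempty (WordSet α)).map (Quotient.mk _)

theorem isHom_mk {α : Type} [Nonempty α] (E : Set (Multiset α)) :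
    Alg.IsHom (A := setAlg α) (B := syntacticAlg E) (Quotient.mk (syntacticSetoid E)) :=
  ⟨fun _ _ => rfl, fun _ _ => rfl⟩

theorem bind_mem_words {α : Type} [Nonempty α] {ρ : ℕ → setAlg α} {τ : ℕ → Multiset α}
    (hτ : ∀ n, τ n ∈ (ρ n).words) {t : Term} {m : Multiset ℕ} (hm : m ∈ t.mons) :
    m.bind τ ∈ (t.eval ρ).words := by
  induction t generalizing m with
  | var n =>
    obtain rfl : m = {n} := hm
    rw [Multiset.singleton_bind]
    exact hτ n
  | add s t hs ht => exact hm.imp hs ht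
  | mul s t hs ht =>
    obtain ⟨p, hp, q, hq, rfl⟩ := hm
    exact ⟨_, hs hp, _, ht hq, (Multiset.add_bind _ _ _).symm⟩

/-- A word in the value of `t` arises by choosing a word separately at each occurrence of a
variable. Only for a square-free monomial are these choices guaranteed to come from one
substitution. -/
theorem exists_bind_eq_of_mem_words {α : Type} [Nonempty α] {ρ : ℕ → setAlg α} {t : Term}
    {p : Multiset α} (hp : p ∈ (t.eval ρ).words) : ∃ m ∈ t.mons, m.Nodup →
      ∃ τ : ℕ → Multiset α, (∀ n, τ n ∈ (ρ n).words) ∧ p = m.bind τ := by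
  classical
  induction t generalizing p with
  | var n =>
    refine ⟨{n}, rfl, fun _ => ?_⟩
    choose τ hτ using fun n => (ρ n).nonempty
    refine ⟨Function.update τ n p, fun k => ?_, by simp⟩
    by_cases hk : k = n
    · subst hk
      rw [Function.update_self]
      exact hp
    · rw [Function.update_of_ne hk]
      exact hτ k
  | add s t hs ht =>
    rcases hp with hp | hp
    · obtain ⟨m, hm, h⟩ := hs hp
      exact ⟨m, Or.inl hm, h⟩
    · obtain ⟨m, hm, h⟩ := ht hp
      exact ⟨m, Or.inr hm, h⟩
  | mul s t hs ht =>
    obtain ⟨p, hp, q, hq, rfl⟩ := hp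
    obtain ⟨m, hm, h⟩ := hs hp
    obtain ⟨m', hm', h'⟩ := ht hq
    refine ⟨m + m', ⟨m, hm, m', hm', rfl⟩, fun hd => ?_⟩
    obtain ⟨hd, hd', hdis⟩ := Multiset.nodup_add.1 hd
    obtain ⟨τ, hτ, rfl⟩ := h hd
    obtain ⟨τ', hτ', rfl⟩ := h' hd'
    refine ⟨fun n => if n ∈ m then τ n else τ' n, fun n => ?_, ?_⟩
    · change (if n ∈ m then τ n else τ' n) ∈ (ρ n).words
      split_ifs
      exacts [hτ n, hτ' n]
    · rw [Multiset.add_bind]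
      refine congrArg₂ _ (Multiset.bind_congr fun n hn => (if_pos hn).symm)
        (Multiset.bind_congr fun n hn => (if_neg fun hn' => ?_).symm)
      exact Multiset.disjoint_left.1 hdis hn' hn

theorem Multiset.Nodup.of_bind {α β : Type*} {m : Multiset α} {τ : α → Multiset β}
    (hτ : ∀ n, τ n ≠ 0) (h : (m.bind τ).Nodup) : m.Nodup := by
  rw [Multiset.nodup_iff_ne_cons_cons]
  rintro a m' rfl
  obtain ⟨b, hb⟩ := Multiset.exists_mem_of_ne_zero (hτ a)
  rw [Multiset.cons_bind, Multiset.cons_bind] at h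
  exact Multiset.disjoint_left.1 (Multiset.nodup_add.1 h).2.2 hb
    (Multiset.mem_add.2 (Or.inl hb))

/-- A set of square-free words is syntactically invariant under an implication between terms as
soon as it is so for substitutions of words for variables. -/
theorem words_add_mem_of_forall_bind {α : Type} [Nonempty α] {E : Set (Multiset α)}
    (hE : ∀ e ∈ E, e.Nodup) {s t : Term}
    (h : ∀ (τ : ℕ → Multiset α) (q : Multiset α), (∀ n, τ n ≠ 0) →
      (∀ m ∈ s.mons, m.bind τ + q ∈ E) → ∀ m ∈ t.mons, m.bind τ + q ∈ E)
    (ρ : ℕ → setAlg α) (q : Multiset α) (hs : ∀ p ∈ (s.eval ρ).words, p + q ∈ E) :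
    ∀ p ∈ (t.eval ρ).words, p + q ∈ E := by
  have key : ∀ τ : ℕ → Multiset α, (∀ n, τ n ∈ (ρ n).words) → ∀ m ∈ t.mons, m.bind τ + q ∈ E :=
    fun τ hτ => h τ q (fun n => WordSet.ne_zero_of_mem (hτ n)) fun m hm =>
      hs _ (bind_mem_words hτ hm)
  intro p hp
  obtain ⟨m, hm, hmp⟩ := exists_bind_eq_of_mem_words hp
  choose τ hτ using fun n => (ρ n).nonempty
  -- An arbitrary choice of words already shows that m is square-free, and then p itself comes from
  -- a substitution.
  have hd := hE _ (key τ hτ m hm)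
  obtain ⟨τ', hτ', rfl⟩ := hmp (Multiset.Nodup.of_bind
    (fun n => WordSet.ne_zero_of_mem (hτ n)) (Multiset.nodup_add.1 hd).1)
  exact key τ' hτ' m hm

theorem syntacticAlg_satisfies {α : Type} [Nonempty α] {E : Set (Multiset α)}
    (hE : ∀ e ∈ E, e.Nodup) {s t : Term}
    (h : ∀ (τ : ℕ → Multiset α) (q : Multiset α), (∀ n, τ n ≠ 0) →
      ((∀ m ∈ s.mons, m.bind τ + q ∈ E) ↔ ∀ m ∈ t.mons, m.bind τ + q ∈ E)) :
    (syntacticAlg E).Satisfies (s, t) := by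
  intro ρ
  choose ρ' hρ using fun n => Quotient.exists_rep (s := syntacticSetoid E) (ρ n)
  obtain rfl : (fun n => Quotient.mk (syntacticSetoid E) (ρ' n)) = ρ := funext hρ
  refine ((isHom_mk E).eval ρ' s).symm.trans (Eq.trans ?_ ((isHom_mk E).eval ρ' t))
  refine Quotient.sound fun q => ⟨?_, ?_⟩
  · exact words_add_mem_of_forall_bind hE (fun τ q hτ => (h τ q hτ).1) ρ' q
  · exact words_add_mem_of_forall_bind hE (fun τ q hτ => (h τ q hτ).2) ρ' q

theorem words_eval_letter {α : Type} [Nonempty α] (f : ℕ → α) (t : Term) :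
    (t.eval (A := setAlg α) fun n => WordSet.letter (f n)).words = Multiset.map f '' t.mons := by
  induction t with
  | var n =>
    rw [Term.mons, Set.image_singleton, Multiset.map_singleton]
    rfl
  | add s t hs ht =>
    refine (WordSet.words_add _ _).trans ?_
    rw [hs, ht, Term.mons, Set.image_union]
  | mul s t hs ht =>
    refine (WordSet.words_mul _ _).trans ?_
    rw [hs, ht, Term.mons, Set.image2_image_left, Set.image2_image_right, Set.image_image2]
    simp only [Multiset.map_add]

/-- An identity of the syntactic algebra of `E` preserves the property that all monomials become
elements of `E`. -/
theorem map_mem_of_syntacticAlg_satisfies {α : Type} [Nonempty α] {E : Set (Multiset α)}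
    {s t : Term} (h : (syntacticAlg E).Satisfies (s, t)) (f : ℕ → α)
    (hs : ∀ m ∈ s.mons, m.map f ∈ E) : ∀ m ∈ t.mons, m.map f ∈ E := by
  have h1 := h fun n => Quotient.mk (syntacticSetoid E) (WordSet.letter (f n))
  have h2 := ((isHom_mk E).eval (fun n => WordSet.letter (f n)) s).trans
    (h1.trans ((isHom_mk E).eval _ t).symm)
  -- In the empty context the syntactic congruence compares membership in `E` itself.
  have h3 := (Quotient.exact h2 0).1 (by
    rw [words_eval_letter]
    rintro _ ⟨m, hm, rfl⟩
    rw [add_zero]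
    exact hs m hm)
  intro m hm
  rw [words_eval_letter] at h3
  have := h3 _ ⟨m, hm, rfl⟩
  rwa [add_zero] at this

/-! ### The identity of the cyclic strip -/

instance : Nonempty Kind := ⟨.d⟩

namespace Term

/-- The sum of a nonempty list of terms. -/
def sum (t : Term) (l : List Term) : Term := l.foldr add t

/-- The product of a nonempty list of terms. -/
def prod (t : Term) (l : List Term) : Term := l.foldr mul t

theorem mem_mons_sum {t : Term} {l : List Term} {m : Multiset ℕ} :
    m ∈ (sum t l).mons ↔ ∃ s ∈ t :: l, m ∈ s.mons := by
  induction l with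
  | nil => simp [sum]
  | cons s l ih =>
    change m ∈ s.mons ∪ (sum t l).mons ↔ _
    rw [Set.mem_union, ih]
    simp only [List.mem_cons, exists_eq_or_imp]
    tauto

theorem card_of_mem_mons_prod {t : Term} {l : List Term}
    (h : ∀ s ∈ t :: l, ∀ m ∈ s.mons, m.card = 1) {m : Multiset ℕ} (hm : m ∈ (prod t l).mons) :
    m.card = l.length + 1 := by
  induction l generalizing m with
  | nil => exact h t (by simp) m hm
  | cons s l ih =>
    obtain ⟨p, hp, q, hq, rfl⟩ := hm
    change (p + q).card = _
    rw [Multiset.card_add, h s (by simp) p hp, ih (fun r hr => h r ?_) hq, List.length_cons]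
    · omega
    · rcases List.mem_cons.1 hr with rfl | hr <;> simp [*]

end Term

/-! ### The strip identity holds in `S₇⁰` and fails in the syntactic algebra -/

namespace S70

/-- An element of `S₇` as an element of `S₇⁰`. -/
def ofS7 (c : S7Carrier) : S70 := (c : WithZero S7Carrier)

/-- The new element `0`. -/
def zero : S70 := (0 : WithZero S7Carrier)

theorem eq_zero_or_ofS7 (x : S70) : x = zero ∨ ∃ c, x = ofS7 c := by
  rcases x with _ | c
  exacts [Or.inl rfl, Or.inr ⟨c, rfl⟩]

theorem ofS7_injective : Function.Injective ofS7 := Option.some_injective _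

theorem ofS7_add (b c : S7Carrier) : ofS7 b + ofS7 c = ofS7 (b + c) := rfl

theorem ofS7_mul (b c : S7Carrier) : ofS7 b * ofS7 c = ofS7 (b * c) := rfl

theorem add_zero (x : S70) : x + zero = x := by cases x <;> rfl

theorem zero_mul (x : S70) : zero * x = zero := by cases x <;> rfl

theorem mul_zero (x : S70) : x * zero = zero := by cases x <;> rfl

theorem inf_add (x : S70) : ofS7 .inf + x = ofS7 .inf := by
  rcases eq_zero_or_ofS7 x with rfl | ⟨c, rfl⟩
  · exact add_zero _
  · cases c <;> rfl

theorem eval_prod_eq_zero {ρ : ℕ → S70} {t : Term} {l : List Term}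
    (h : ∃ s ∈ t :: l, s.eval ρ = zero) : (Term.prod t l).eval ρ = zero := by
  induction l with
  | nil =>
    obtain ⟨r, hr, h⟩ := h
    exact List.mem_singleton.1 hr ▸ h
  | cons s l ih =>
    change s.eval ρ * (Term.prod t l).eval ρ = zero
    obtain ⟨r, hr, h⟩ := h
    rcases List.mem_cons.1 hr with rfl | hr
    · rw [ih ⟨r, by simp, h⟩, mul_zero]
    · rcases List.mem_cons.1 hr with rfl | hr
      · rw [h, zero_mul]
      · rw [ih ⟨r, by simp [hr], h⟩, mul_zero]

theorem eval_prod_eq_one {ρ : ℕ → S70} {t : Term} {l : List Term}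
    (h : ∀ s ∈ t :: l, s.eval ρ = ofS7 .one) : (Term.prod t l).eval ρ = ofS7 .one := by
  induction l with
  | nil => exact h t (by simp)
  | cons s l ih =>
    change s.eval ρ * (Term.prod t l).eval ρ = _
    rw [h s (by simp), ih fun r hr => h r (by rcases List.mem_cons.1 hr with rfl | hr <;> simp [*])]
    rfl

/-- A sum of elements of `S₇` is `∞`, or all summands are equal to it. -/
theorem eval_sum {ρ : ℕ → S70} {t : Term} {l : List Term}
    (h : ∀ s ∈ t :: l, ∃ c, s.eval ρ = ofS7 c) :
    ∃ c, (Term.sum t l).eval ρ = ofS7 c ∧ (c ≠ .inf → ∀ s ∈ t :: l, s.eval ρ = ofS7 c) := by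
  have key : ∀ b c : S7Carrier, b + c ≠ .inf → b + c = b ∧ b + c = c := by decide
  induction l with
  | nil =>
    obtain ⟨c, hc⟩ := h t (by simp)
    exact ⟨c, hc, fun _ s hs => by rwa [List.mem_singleton.1 hs]⟩
  | cons s l ih =>
    obtain ⟨b, hb, hb'⟩ :=
      ih fun r hr => h r (by rcases List.mem_cons.1 hr with rfl | hr <;> simp [*])
    obtain ⟨c, hc⟩ := h s (by simp)
    refine ⟨c + b, ?_, fun hcb r hr => ?_⟩
    · change s.eval ρ + (Term.sum t l).eval ρ = _
      rw [hc, hb, ofS7_add]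
    · obtain ⟨h1, h2⟩ := key c b hcb
      have h3 := hb' (h2 ▸ hcb)
      rw [h2]
      rcases List.mem_cons.1 hr with rfl | hr
      · exact h3 r (by simp)
      · rcases List.mem_cons.1 hr with rfl | hr
        · rw [hc, ← h1, h2]
        · exact h3 r (by simp [hr])

end S70

section

variable (M : ℕ) [NeZero M]

/-- The variable of a vertex of the cyclic strip. -/
noncomputable def vertexVar (v : Kind × ZMod M) : Term :=
  .var (Fintype.equivFin (Kind × ZMod M) v).val

/-- The vertex of a variable. -/
noncomputable def varVertex (n : ℕ) : Kind × ZMod M :=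
  if h : n < Fintype.card (Kind × ZMod M) then (Fintype.equivFin (Kind × ZMod M)).symm ⟨n, h⟩
  else (.d, 0)

/-- The product of the variables of three vertices. -/
noncomputable def tripleTerm (u v w : Kind × ZMod M) : Term :=
  .mul (.mul (vertexVar M u) (vertexVar M v)) (vertexVar M w)

/-- The monomials of the hyperedges of the cyclic strip. -/
noncomputable def edgeTerms : List Term :=
  (Finset.univ : Finset (ZMod M)).toList.flatMap fun i =>
    [tripleTerm M (.d, i) (.d, i + 1) (.x, i), tripleTerm M (.d, i) (.y, i + 1) (.z, i - 2),
      tripleTerm M (.x, i) (.y, i) (.z, i)]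

/-- The sum of the hyperedges of the cyclic strip. -/
noncomputable def stripSum : Term :=
  .sum (tripleTerm M (.d, 0) (.d, 0 + 1) (.x, 0)) (edgeTerms M)

/-- The product of all vertices of the cyclic strip. -/
noncomputable def stripProd : Term :=
  .prod (vertexVar M (.d, 0)) ((Finset.univ : Finset (Kind × ZMod M)).toList.map (vertexVar M))

variable {M}

theorem varVertex_equivFin (v : Kind × ZMod M) :
    varVertex M (Fintype.equivFin (Kind × ZMod M) v).val = v := by
  rw [varVertex, dif_pos (Fin.is_lt _)]
  exact Equiv.symm_apply_apply _ v

theorem map_mem_of_mem_mons_stripSum {m : Multiset ℕ} (hm : m ∈ (stripSum M).mons) :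
    m.map (varVertex M) ∈ stripEdges (ZMod M) := by
  have triple : ∀ u v w, ∀ m ∈ (tripleTerm M u v w).mons, m.map (varVertex M) = {u, v, w} := by
    rintro u v w _ ⟨_, ⟨_, rfl, _, rfl, rfl⟩, _, rfl, rfl⟩
    change Multiset.map _ ({_} + {_} + {_}) = _
    simp only [Multiset.map_add, Multiset.map_singleton, varVertex_equivFin]
    rfl
  obtain ⟨s, hs, hm⟩ := Term.mem_mons_sum.1 hm
  rcases List.mem_cons.1 hs with rfl | hs
  · exact ⟨0, Or.inl (triple _ _ _ _ hm)⟩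
  · obtain ⟨i, -, hi⟩ := List.mem_flatMap.1 hs
    simp only [List.mem_cons, List.not_mem_nil, or_false] at hi
    rcases hi with rfl | rfl | rfl
    · exact ⟨i, Or.inl (triple _ _ _ _ hm)⟩
    · exact ⟨i, Or.inr (Or.inl (triple _ _ _ _ hm))⟩
    · exact ⟨i, Or.inr (Or.inr (triple _ _ _ _ hm))⟩

/-- The extra 1 is the vertex (d, 0), which also starts the product. Only the difference from 3
matters later. -/
theorem card_of_mem_mons_stripProd {m : Multiset ℕ} (hm : m ∈ (stripProd M).mons) :
    m.card = 4 * M + 1 := by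
  rw [Term.card_of_mem_mons_prod _ hm, List.length_map, Finset.length_toList, Finset.card_univ,
    Fintype.card_prod, ZMod.card]
  · rfl
  · intro s hs
    have : ∃ v, vertexVar M v = s := by
      rcases List.mem_cons.1 hs with rfl | hs
      · exact ⟨_, rfl⟩
      · obtain ⟨v, -, h⟩ := List.mem_map.1 hs
        exact ⟨v, h⟩
    obtain ⟨v, rfl⟩ := this
    rintro _ rfl
    exact Multiset.card_singleton _

/-- The syntactic algebra of the hyperedges of the cyclic strip fails the identity by which the
product of all vertices can be added to the sum of the hyperedges. -/
theorem not_syntacticAlg_satisfies :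
    ¬ (syntacticAlg (stripEdges (ZMod M))).Satisfies
      (stripSum M, .add (stripSum M) (stripProd M)) := by
  intro h
  obtain ⟨m, hm⟩ := (stripProd M).mons_nonempty
  have h1 := map_mem_of_syntacticAlg_satisfies h (varVertex M)
    (fun m hm => map_mem_of_mem_mons_stripSum hm) m (Or.inr hm)
  have h2 := card_of_mem_stripEdges h1
  rw [Multiset.card_map, card_of_mem_mons_stripProd hm] at h2
  have := NeZero.pos M
  omega

/-- The identity of a cyclic strip whose length is not divisible by three holds in `S₇⁰`. -/
theorem S70_satisfies (hM : ¬ 3 ∣ M) :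
    S70.Satisfies (stripSum M, .add (stripSum M) (stripProd M)) := by
  intro ρ
  change (stripSum M).eval ρ = (stripSum M).eval ρ + (stripProd M).eval ρ
  -- A vertex with value 0 makes the product 0, which is neutral for addition. Otherwise all values
  -- lie in S₇.
  by_cases h0 : ∃ v, (vertexVar M v).eval ρ = S70.zero
  · obtain ⟨v, hv⟩ := h0
    have hprod : (stripProd M).eval ρ = S70.zero :=
      S70.eval_prod_eq_zero ⟨_, by simp, hv⟩
    rw [hprod, S70.add_zero]
  have h1 : ∀ v, ∃ c, (vertexVar M v).eval ρ = S70.ofS7 c :=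
    fun v => (S70.eq_zero_or_ofS7 _).resolve_left fun h => h0 ⟨v, h⟩
  choose g hg using h1
  have htriple : ∀ u v w, (tripleTerm M u v w).eval ρ = S70.ofS7 (g u * g v * g w) := by
    intro u v w
    change (vertexVar M u).eval ρ * (vertexVar M v).eval ρ * (vertexVar M w).eval ρ = _
    rw [hg, hg, hg, S70.ofS7_mul, S70.ofS7_mul]
  obtain ⟨c, hc, hc'⟩ := S70.eval_sum (ρ := ρ)
    (t := tripleTerm M (.d, 0) (.d, 0 + 1) (.x, 0)) (l := edgeTerms M) (by
      intro s hs
      rcases List.mem_cons.1 hs with rfl | hs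
      · exact ⟨_, htriple _ _ _⟩
      · obtain ⟨i, -, hi⟩ := List.mem_flatMap.1 hs
        simp only [List.mem_cons, List.not_mem_nil, or_false] at hi
        rcases hi with rfl | rfl | rfl <;> exact ⟨_, htriple _ _ _⟩)
  change (stripSum M).eval ρ = _ at hc
  rw [hc]
  by_cases hinf : c = .inf
  · rw [hinf, S70.inf_add]
  have hmem : ∀ s i, s ∈ [tripleTerm M (.d, i) (.d, i + 1) (.x, i),
      tripleTerm M (.d, i) (.y, i + 1) (.z, i - 2), tripleTerm M (.x, i) (.y, i) (.z, i)] →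
      s.eval ρ = S70.ofS7 c :=
    fun s i hs => hc' hinf s (List.mem_cons_of_mem _ (List.mem_flatMap.2 ⟨i, by simp, hs⟩))
  have top : ∀ i, g (.d, i) * g (.d, i + 1) * g (.x, i) = c := fun i =>
    S70.ofS7_injective ((htriple _ _ _).symm.trans (hmem _ i (by simp)))
  have diag : ∀ i, g (.d, i) * g (.y, i + 1) * g (.z, i - 2) = c := fun i =>
    S70.ofS7_injective ((htriple _ _ _).symm.trans (hmem _ i (by simp)))
  have col : ∀ i, g (.x, i) * g (.y, i) * g (.z, i) = c := fun i =>
    S70.ofS7_injective ((htriple _ _ _).symm.trans (hmem _ i (by simp)))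
  rcases c with _ | _ | _
  · exact absurd rfl hinf
  -- A product of three elements equals a only if exactly one factor is a, so the vertices with
  -- value a form an exact cover.
  · refine absurd (three_dvd_of_exact_cover (fun v => if g v = .a then 1 else 0) ?_ ?_ ?_) hM
    all_goals
      have key : ∀ b c e : S7Carrier, b * c * e = .a →
        ((if b = .a then 1 else 0) + (if c = .a then 1 else 0) +
          (if e = .a then 1 else 0) : ℤ) = 1 := by decide
    exacts [fun i => key _ _ _ (top i), fun i => key _ _ _ (diag i), fun i => key _ _ _ (col i)]
  · have key : ∀ b c e : S7Carrier, b * c * e = .one → b = .one ∧ c = .one ∧ e = .one := by decide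
    have hone : ∀ v, g v = .one := by
      rintro ⟨k, i⟩
      cases k
      exacts [(key _ _ _ (top i)).1, (key _ _ _ (col i)).1, (key _ _ _ (col i)).2.1,
        (key _ _ _ (col i)).2.2]
    have hprod : (stripProd M).eval ρ = S70.ofS7 .one := by
      refine S70.eval_prod_eq_one fun s hs => ?_
      rcases List.mem_cons.1 hs with rfl | hs
      · rw [hg, hone]
      · obtain ⟨v, -, rfl⟩ := List.mem_map.1 hs
        rw [hg, hone]
    rw [hprod]
    rfl

end

/-! ### Nonfinite basis and the main theorem -/

theorem syntacticAlg_satisfies_of_ScABC {M : ℕ} [NeZero M] [Nontrivial (ZMod M)] {e : Term × Term}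
    (h : ScABC.Satisfies e) (h₁ : 2 * (3 * e.1.vars.card + 3) < M)
    (h₂ : 2 * (3 * e.2.vars.card + 3) < M) :
    (syntacticAlg (stripEdges (ZMod M))).Satisfies e :=
  syntacticAlg_satisfies (fun _ he => nodup_of_mem_stripEdges he) fun _ _ hτ =>
    ⟨mem_stripEdges_of_satisfies h h₁ hτ,
      mem_stripEdges_of_satisfies (fun ρ => (h ρ).symm) h₂ hτ⟩

theorem not_finitelyBased {V : Set Alg.{u}} (h₁ : ScABC.lift ∈ V)
    (h₂ : V ⊆ varietyGen S70.lift) : ¬ FinitelyBased V := by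
  rintro ⟨E, hE, rfl⟩
  obtain ⟨N, hN⟩ := (hE.image fun e => max e.1.vars.card e.2.vars.card).bddAbove
  have hN' : ∀ e ∈ E, e.1.vars.card ≤ N ∧ e.2.vars.card ≤ N :=
    fun e he => max_le_iff.1 (hN ⟨e, he, rfl⟩)
  -- M = 6N + 10 exceeds the bound 2(3N + 3) for identities with at most N variables on each side,
  -- and M ≡ 1 modulo 3.
  obtain ⟨M, hM⟩ : ∃ M, M = 3 * (2 * (N + 1) + 1) + 1 := ⟨_, rfl⟩
  have : NeZero M := ⟨by omega⟩
  have : Fact (1 < M) := ⟨by omega⟩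
  have hA : (syntacticAlg (stripEdges (ZMod M))).lift.{u} ∈ {A | ∀ e ∈ E, A.Satisfies e} := by
    intro e he
    have := hN' e he
    exact Alg.satisfies_lift_iff.2 (syntacticAlg_satisfies_of_ScABC
      (Alg.satisfies_lift_iff.1 (h₁ e he)) (by omega) (by omega))
  exact not_syntacticAlg_satisfies (Alg.satisfies_lift_iff.1
    (satisfies_of_mem_varietyGen (h₂ hA)
      (Alg.satisfies_lift_iff.2 (S70_satisfies (M := M) (by omega)))))

/-- With `V(A)` the variety generated by `A`: the interval `[V(S_c(abc)), V(S₇⁰)]` makes sense,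
every variety in it is nonfinitely based, and every subvariety of `V(S₇⁰)` that contains `S₇` and
the 2-element distributive lattice belongs to it (so it is nonfinitely based as well). -/
theorem mainTheorem4 :
    varietyGen ScABC.lift.{u} ⊆ varietyGen S70.lift.{u} ∧
    (∀ V ∈ varietyInterval (varietyGen ScABC.lift.{u}) (varietyGen S70.lift.{u}),
      ¬ FinitelyBased V) ∧
    (∀ V : Set Alg.{u}, IsVariety V → V ⊆ varietyGen S70.lift.{u} →
      S7.lift.{u} ∈ V → D2.lift.{u} ∈ V →
      V ∈ varietyInterval (varietyGen ScABC.lift.{u}) (varietyGen S70.lift.{u}) ∧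
      ¬ FinitelyBased V) := by
  refine ⟨?_, ?_, ?_⟩
  · have hV := isVariety_varietyGen S70.lift.{u}
    exact varietyGen_subset hV
      (ScABC_mem_of_S7_mem hV (S7_mem_of_S70_mem hV (mem_varietyGen_self _)))
  · rintro V ⟨-, h₁, h₂⟩
    exact not_finitelyBased (h₁ (mem_varietyGen_self _)) h₂
  · intro V hV h₂ h₇ _
    have h₁ := ScABC_mem_of_S7_mem hV h₇
    exact ⟨⟨hV, varietyGen_subset hV h₁, h₂⟩, not_finitelyBased h₁ h₂⟩
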